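/- Let $\mathbb N=\{0,1,2,\dots\}$, and let $\bmod:\mathbb N^2\to\mathbb N$ be the operation for which, when $y\ge 1$, $x \bmod y$ is the remainder of $x$ divided by $y$ (the unique $r\in\mathbb N$ with $0\le r<y$ and $x=qy+r$ for some $q\in\mathbb N$), and for which $x\bmod 0:=x$. Then the (complete) first-order theory of the structure $(\mathbb N,\bmod)$ is undecidable. That is, consider the first-order language with equality whose only non-logical symbol is one binary function symbol, interpreted in $\mathbb N$ by $\bmod$; then there is no algorithm (equivalently, no total computable function on Gödel numbers, for a standard effective Gödel numbering of the sentences of this language) that decides, for every sentence $\varphi$ of this language, whether $(\mathbb N,\bmod)\models\varphi$. -/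

import Mathlib

namespace ModArith

/-- The function symbols: one binary symbol. -/
inductive ModFunc : ℕ → Type
  | mod : ModFunc 2

/-- The first-order language (with equality) whose only non-logical symbol is a
binary function symbol `mod`. -/
def modLanguage : FirstOrder.Language.{0, 0} where
  Functions := ModFunc
  Relations := fun _ => Empty

/-- The structure `(ℕ, mod)`. Mathlib's remainder on `ℕ` satisfies `x % 0 = x`. -/
instance natModStructure : modLanguage.Structure ℕ where
  funMap := fun {_} f =>
    match f with
    | ModFunc.mod => fun v => v 0 % v 1
  RelMap := fun {_} r => Empty.elim r

/-- Gödel numbers of terms whose variables are the `n` de Bruijn levels in scope. -/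
def termCode {n : ℕ} : modLanguage.Term (Empty ⊕ Fin n) → ℕ
  | .var (Sum.inl e) => e.elim
  | .var (Sum.inr i) => 2 * i
  | .func ModFunc.mod ts => 2 * Nat.pair (termCode (ts 0)) (termCode (ts 1)) + 1

/-- Gödel numbers of formulas without free variables other than the `n` de Bruijn levels in
scope, by recursion over the primitive formulas `⊥`, `t₁ = t₂`, `φ → ψ`, `∀ φ`. -/
def formulaCode : {n : ℕ} → modLanguage.BoundedFormula Empty n → ℕ
  | _, .falsum => 0
  | _, .equal t₁ t₂ => 3 * Nat.pair (termCode t₁) (termCode t₂) + 1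
  | _, .rel R _ => Empty.elim R
  | _, .imp φ ψ => 3 * Nat.pair (formulaCode φ) (formulaCode ψ) + 2
  | _, .all φ => 3 * formulaCode φ + 3

/-- The Gödel number of a sentence. -/
def sentenceCode (φ : modLanguage.Sentence) : ℕ := formulaCode φ

theorem termCode_injective {n : ℕ} :
    Function.Injective (termCode : modLanguage.Term (Empty ⊕ Fin n) → ℕ) := by
  intro s
  induction s with
  | var x =>
    rcases x with e | i
    · exact e.elim
    · rintro ((e | j) | ⟨⟨⟩, us⟩) h
      · exact e.elim
      · simp only [termCode] at h
        have hij : i = j := Fin.ext (by omega)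
        rw [hij]
      · simp only [termCode] at h
        omega
  | func f ts ih =>
    cases f
    rintro ((e | j) | ⟨⟨⟩, us⟩) h
    · exact e.elim
    · simp only [termCode] at h
      omega
    · simp only [termCode] at h
      have hp : Nat.pair (termCode (ts 0)) (termCode (ts 1)) =
          Nat.pair (termCode (us 0)) (termCode (us 1)) := by omega
      obtain ⟨h0, h1⟩ := Nat.pair_eq_pair.1 hp
      congr 1
      funext k
      fin_cases k
      · exact ih 0 h0
      · exact ih 1 h1

theorem formulaCode_injective {n : ℕ} :
    Function.Injective (formulaCode : modLanguage.BoundedFormula Empty n → ℕ) := by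
  intro φ
  induction φ with
  | falsum =>
    intro ψ h
    cases ψ with
    | rel R => exact Empty.elim R
    | falsum => rfl
    | _ => simp only [formulaCode] at h; omega
  | equal t₁ t₂ =>
    intro ψ h
    cases ψ with
    | rel R => exact Empty.elim R
    | equal u₁ u₂ =>
      simp only [formulaCode] at h
      obtain ⟨h0, h1⟩ := Nat.pair_eq_pair.1
        (show Nat.pair (termCode t₁) (termCode t₂) = Nat.pair (termCode u₁) (termCode u₂) by omega)
      rw [termCode_injective h0, termCode_injective h1]
    | _ => simp only [formulaCode] at h; omega
  | rel R => exact Empty.elim R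
  | imp φ₁ φ₂ ih₁ ih₂ =>
    intro ψ h
    cases ψ with
    | rel R => exact Empty.elim R
    | imp ψ₁ ψ₂ =>
      simp only [formulaCode] at h
      obtain ⟨h0, h1⟩ := Nat.pair_eq_pair.1
        (show Nat.pair (formulaCode φ₁) (formulaCode φ₂) =
          Nat.pair (formulaCode ψ₁) (formulaCode ψ₂) by omega)
      rw [ih₁ h0, ih₂ h1]
    | _ => simp only [formulaCode] at h; omega
  | all φ ih =>
    intro ψ h
    cases ψ with
    | rel R => exact Empty.elim R
    | all ψ =>
      simp only [formulaCode] at h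
      rw [ih (show formulaCode φ = formulaCode ψ by omega)]
    | _ => simp only [formulaCode] at h; omega

theorem sentenceCode_injective : Function.Injective sentenceCode :=
  formulaCode_injective

/-- A set `T` of sentences is decidable if some total computable function, given the Gödel number
of an arbitrary sentence, correctly answers whether the sentence belongs to `T`. No condition is
put on inputs that are not Gödel numbers. -/
def IsDecidable (T : modLanguage.Theory) : Prop :=
  ∃ f : ℕ → Bool, Computable f ∧
    ∀ φ : modLanguage.Sentence, f (sentenceCode φ) = true ↔ φ ∈ T

end ModArith

/-!
Addition and multiplication are first-order definable in `(ℕ, mod)`, so every partial recursive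
function has a definable graph, and a decision procedure for the theory would solve the halting
problem.

The order is definable, as `x < y` means `y ≠ 0` and `x % y = x`, and so is divisibility. The
number `2 * a` is the least multiple of `a` exceeding `a` (for `a ≠ 0`), and for `b < a` the sum
`a + b` is the number in `[a, 2 * a)` that leaves the remainder `b` modulo `a`; this defines
addition (`DefFun.add`). Since `x` and `x + 1` are coprime, `x * x + x` is their least common
multiple, which defines squaring (`DefFun.sq`), and the binomial formula for `(x + y) * (x + y)`
then defines multiplication (`DefFun.mul`), the pairing function `Nat.pair`, and
Gödel's function `Nat.beta`.

With these, induction on `Nat.Partrec` shows that graphs of partial recursive functions are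
definable (`defPred_graph_of_partrec`); primitive recursion is handled by coding the sequence of
intermediate values with `Nat.beta`. In particular some formula `φ x` defines the set of (numbers
of) programs halting on input `0`. The language has no numerals, so the sentence stating `φ m` is
written as `∀ x, x < m + 1 → ¬ x < m → φ x`, with `x < m` expressed by `m` nested quantifiers
(`ltFormula`); its Gödel number is a primitive recursive function of `m`
(`primrec_sentenceCode_instantiate`). Hence deciding the theory decides every definable set
(`computablePred_of_isDecidable`), against the undecidability of the halting problem.
-/

namespace ModArith

open FirstOrder FirstOrder.Language Set

/-! ### Closure properties of definability -/

/-- A predicate on tuples of natural numbers that is first-order definable, without parameters,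
in `(ℕ, mod)`. -/
abbrev DefPred {α : Type} (P : (α → ℕ) → Prop) : Prop :=
  (∅ : Set ℕ).Definable modLanguage {v : α → ℕ | P v}

/-- A function on tuples of natural numbers whose graph is first-order definable, without
parameters, in `(ℕ, mod)`. -/
abbrev DefFun {α : Type} (f : (α → ℕ) → ℕ) : Prop :=
  (∅ : Set ℕ).DefinableFun modLanguage f

namespace DefPred

variable {α : Type} {P Q : (α → ℕ) → Prop}

theorem of_iff (hP : DefPred P) (h : ∀ v, Q v ↔ P v) : DefPred Q := by
  have : Q = P := funext fun v => propext (h v)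
  exact this ▸ hP

protected theorem and (hP : DefPred P) (hQ : DefPred Q) : DefPred fun v => P v ∧ Q v :=
  Definable.inter hP hQ

protected theorem or (hP : DefPred P) (hQ : DefPred Q) : DefPred fun v => P v ∨ Q v :=
  Definable.union hP hQ

protected theorem not (hP : DefPred P) : DefPred fun v => ¬ P v :=
  Definable.compl hP

protected theorem imp (hP : DefPred P) (hQ : DefPred Q) : DefPred fun v => P v → Q v :=
  (hP.not.or hQ).of_iff fun _ => imp_iff_not_or

/-- Closure under existential quantification; the bound variable is stored at `none`. -/
theorem ex [Finite α] {P : (α → ℕ) → ℕ → Prop}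
    (hP : DefPred fun w : Option α → ℕ => P (fun i => w (some i)) (w none)) :
    DefPred fun v => ∃ x, P v x := by
  have h := Definable.image_comp hP (some : α → Option α)
  refine DefPred.of_iff h fun v => ⟨fun ⟨x, hx⟩ => ?_, ?_⟩
  · exact ⟨fun o => o.elim x v, hx, rfl⟩
  · rintro ⟨w, hw, rfl⟩
    exact ⟨w none, hw⟩

/-- Closure under universal quantification; the bound variable is stored at `none`. -/
protected theorem all [Finite α] {P : (α → ℕ) → ℕ → Prop}
    (hP : DefPred fun w : Option α → ℕ => P (fun i => w (some i)) (w none)) :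
    DefPred fun v => ∀ x, P v x :=
  (DefPred.ex (P := fun v x => ¬ P v x) hP.not).not.of_iff fun v => by
    simp only [not_exists, not_not]

/-- Substitution of definable functions for the two arguments of a definable relation. -/
theorem subst₂ {R : ℕ → ℕ → Prop} (hR : DefPred fun v : Fin 2 → ℕ => R (v 0) (v 1))
    {f g : (α → ℕ) → ℕ} (hf : DefFun f) (hg : DefFun g) : DefPred fun v => R (f v) (g v) := by
  refine Definable.preimage_map (F := fun v => ![f v, g v]) (fun i => ?_) hR
  fin_cases i
  · exact hf
  · exact hg

protected theorem eq {f g : (α → ℕ) → ℕ} (hf : DefFun f) (hg : DefFun g) :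
    DefPred fun v => f v = g v :=
  DefinableFun.ofPred_eq hf hg

end DefPred

namespace DefFun

variable {α : Type} {f g : (α → ℕ) → ℕ}

protected theorem var (i : α) : DefFun fun v => v i := DefinableFun.proj modLanguage

/-- A function is definable if its graph is; the value is stored at `none`. -/
theorem of_graph {R : (α → ℕ) → ℕ → Prop}
    (hR : DefPred fun w : Option α → ℕ => R (fun i => w (some i)) (w none))
    (h : ∀ v z, f v = z ↔ R v z) : DefFun f :=
  DefPred.of_iff hR fun _ => h _ _

/-- Substitution of definable functions for the two arguments of a definable operation. -/
theorem subst₂ {op : ℕ → ℕ → ℕ} (hop : DefFun fun v : Fin 2 → ℕ => op (v 0) (v 1))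
    (hf : DefFun f) (hg : DefFun g) : DefFun fun v => op (f v) (g v) := by
  refine DefinableFun.comp (g := fun v => ![f v, g v]) (fun i => ?_) hop
  fin_cases i
  · exact hf
  · exact hg

protected theorem mod (hf : DefFun f) (hg : DefFun g) : DefFun fun v => f v % g v :=
  have h : DefFun fun v : Fin 2 → ℕ => v 0 % v 1 :=
    DefinableFun.fun_symbol (L := modLanguage) ModFunc.mod
  subst₂ h hf hg

/-- `0` is the only number equal to its remainder modulo itself. -/
protected theorem zero : DefFun fun _ : α → ℕ => 0 := by
  refine of_graph (R := fun _ z => z = z % z) (.eq (.var _) (.mod (.var _) (.var _))) fun v z => ?_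
  rw [Nat.mod_self, eq_comm]

end DefFun

/-! ### Arithmetic in `(ℕ, mod)` -/

namespace DefPred

variable {α : Type} {f g : (α → ℕ) → ℕ}

protected theorem dvd (hf : DefFun f) (hg : DefFun g) : DefPred fun v => f v ∣ g v :=
  (DefPred.eq (.mod hg hf) .zero).of_iff fun _ => Nat.dvd_iff_mod_eq_zero

/-- `x < y` holds exactly when `x % y = x` and `y ≠ 0`; the second condition is needed because
`x % 0 = x`. -/
protected theorem lt (hf : DefFun f) (hg : DefFun g) : DefPred fun v => f v < g v :=
  ((DefPred.eq (.mod hf hg) hf).and (DefPred.eq hg .zero).not).of_iff fun v => by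
    constructor
    · intro h
      exact ⟨Nat.mod_eq_of_lt h, by omega⟩
    · rintro ⟨h, h0⟩
      rw [← h]
      exact Nat.mod_lt _ (Nat.pos_of_ne_zero h0)

protected theorem le (hf : DefFun f) (hg : DefFun g) : DefPred fun v => f v ≤ g v :=
  (DefPred.lt hg hf).not.of_iff fun _ => not_lt.symm

end DefPred

namespace DefFun

variable {α : Type} {f g : (α → ℕ) → ℕ}

/-- `2 * a` is the least multiple of `a` exceeding `a`, for `a ≠ 0`. -/
theorem two_mul_eq_iff (a c : ℕ) :
    a + a = c ↔ a ∣ c ∧ (a = 0 ∨ a < c) ∧ ∀ w, a ∣ w → a < w → c ≤ w := by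
  constructor
  · rintro rfl
    refine ⟨⟨2, by ring⟩, by omega, ?_⟩
    rintro _ ⟨q, rfl⟩ h
    have hq : 1 < q := lt_of_mul_lt_mul_left ((mul_one a).trans_lt h) a.zero_le
    nlinarith
  · rintro ⟨⟨q, rfl⟩, h, hw⟩
    rcases Nat.eq_zero_or_pos a with rfl | ha
    · simp
    · have h2 := hw (a + a) ⟨2, by ring⟩ (by omega)
      have h1 : 1 < q := by
        by_contra hq
        have : q = 0 ∨ q = 1 := by omega
        rcases this with rfl | rfl <;> omega
      nlinarith

theorem two_mul (hf : DefFun f) : DefFun fun v => f v + f v := by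
  have h : DefFun fun v : Fin 2 → ℕ => v 0 + v 0 := by
    refine of_graph (R := fun v c => v 0 ∣ c ∧ (v 0 = 0 ∨ v 0 < c) ∧
      ∀ w, v 0 ∣ w → v 0 < w → c ≤ w) ?_ fun v c => two_mul_eq_iff _ _
    exact .and (.dvd (.var _) (.var _)) <| .and (.or (.eq (.var _) .zero) (.lt (.var _) (.var _))) <|
      .all <| .imp (.dvd (.var _) (.var _)) <| .imp (.lt (.var _) (.var _)) <|
        .le (.var _) (.var _)
  exact subst₂ (op := fun a _ => a + a) h hf hf

/-- For `b < a`, the sum `a + b` is the number in `[a, 2 * a)` with remainder `b` modulo `a`. -/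
theorem add_eq_iff_of_lt {a b : ℕ} (h : b < a) (c : ℕ) :
    a + b = c ↔ c % a = b ∧ a ≤ c ∧ c < a + a := by
  constructor
  · rintro rfl
    refine ⟨?_, by omega, by omega⟩
    rw [Nat.add_mod_left, Nat.mod_eq_of_lt h]
  · rintro ⟨rfl, h1, h2⟩
    rw [Nat.mod_eq_sub_mod h1, Nat.mod_eq_of_lt (by omega)]
    omega

protected theorem add (hf : DefFun f) (hg : DefFun g) : DefFun fun v => f v + g v := by
  -- the graph of addition on the pairs with `b < a`
  have hlt {i j k : Option (Fin 2)} : DefPred fun w : Option (Fin 2) → ℕ =>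
      w j < w i ∧ w k % w i = w j ∧ w i ≤ w k ∧ w k < w i + w i :=
    .and (.lt (.var _) (.var _)) <| .and (.eq (.mod (.var _) (.var _)) (.var _)) <|
      .and (.le (.var _) (.var _)) (.lt (.var _) (two_mul (.var _)))
  refine subst₂ (op := fun a b => a + b) (of_graph (R := fun v c =>
    (v 1 < v 0 ∧ c % v 0 = v 1 ∧ v 0 ≤ c ∧ c < v 0 + v 0) ∨
    (v 0 < v 1 ∧ c % v 1 = v 0 ∧ v 1 ≤ c ∧ c < v 1 + v 1) ∨
    (v 0 = v 1 ∧ v 0 + v 0 = c)) ?_ fun v c => ?_) hf hg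
  · exact .or hlt <| .or hlt <| .and (.eq (.var _) (.var _)) (.eq (two_mul (.var _)) (.var _))
  · rcases lt_trichotomy (v 0) (v 1) with h | h | h
    · rw [add_comm, add_eq_iff_of_lt h]
      simp [h, h.not_gt, h.ne]
    · simp [h]
    · rw [add_eq_iff_of_lt h]
      simp [h, h.not_gt, h.ne']

/-- `1` is the number dividing every number. -/
protected theorem one : DefFun fun _ : Fin 2 → ℕ => 1 := by
  refine of_graph (R := fun _ z => ∀ y, z ∣ y) (.all (.dvd (.var _) (.var _))) fun v z => ?_
  constructor
  · rintro rfl y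
    exact one_dvd y
  · intro h
    exact (Nat.dvd_one.1 (h 1)).symm

theorem succ (hf : DefFun f) : DefFun fun v => f v + 1 :=
  subst₂ (op := fun a _ => a + 1) (.add (.var 0) .one) hf hf

theorem lcm (hf : DefFun f) (hg : DefFun g) : DefFun fun v => Nat.lcm (f v) (g v) := by
  refine subst₂ (op := Nat.lcm) (of_graph (R := fun v z =>
    v 0 ∣ z ∧ v 1 ∣ z ∧ ∀ w, v 0 ∣ w → v 1 ∣ w → z ∣ w) ?_ fun v z => ?_) hf hg
  · exact .and (.dvd (.var _) (.var _)) <| .and (.dvd (.var _) (.var _)) <| .all <|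
      .imp (.dvd (.var _) (.var _)) <| .imp (.dvd (.var _) (.var _)) <| .dvd (.var _) (.var _)
  · constructor
    · rintro rfl
      exact ⟨Nat.dvd_lcm_left _ _, Nat.dvd_lcm_right _ _, fun _ => Nat.lcm_dvd⟩
    · rintro ⟨h0, h1, h⟩
      exact Nat.dvd_antisymm (Nat.lcm_dvd h0 h1)
        (h _ (Nat.dvd_lcm_left _ _) (Nat.dvd_lcm_right _ _))

/-- Squaring is definable because `x * x + x` is the least common multiple of the coprime numbers
`x` and `x + 1`. -/
theorem sq (hf : DefFun f) : DefFun fun v => f v * f v := by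
  refine subst₂ (op := fun a _ => a * a) (of_graph (R := fun v z =>
    z + v 0 = Nat.lcm (v 0) (v 0 + 1)) ?_ fun v z => ?_) hf hf
  · exact .eq (.add (.var _) (.var _)) (.lcm (.var _) (.succ (.var _)))
  · have h : Nat.lcm (v 0) (v 0 + 1) = v 0 * (v 0 + 1) :=
      Nat.Coprime.lcm_eq_mul (by simp)
    rw [h, mul_add, mul_one, Nat.add_right_cancel_iff, eq_comm]

/-- Multiplication is definable from squaring by the binomial formula. -/
protected theorem mul (hf : DefFun f) (hg : DefFun g) : DefFun fun v => f v * g v := by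
  refine subst₂ (op := fun a b => a * b) (of_graph (R := fun v z =>
    z + z + (v 0 * v 0 + v 1 * v 1) = (v 0 + v 1) * (v 0 + v 1)) ?_ fun v z => ?_) hf hg
  · exact .eq (.add (.add (.var _) (.var _)) (.add (.sq (.var _)) (.sq (.var _))))
      (.sq (.add (.var _) (.var _)))
  · have h : (v 0 + v 1) * (v 0 + v 1) =
        v 0 * v 1 + v 0 * v 1 + (v 0 * v 0 + v 1 * v 1) := by ring
    rw [h]
    omega

theorem pair (hf : DefFun f) (hg : DefFun g) : DefFun fun v => Nat.pair (f v) (g v) := by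
  refine subst₂ (op := Nat.pair) (of_graph (R := fun v z =>
    (v 0 < v 1 ∧ v 1 * v 1 + v 0 = z) ∨ (¬ v 0 < v 1 ∧ v 0 * v 0 + v 0 + v 1 = z))
    ?_ fun v z => ?_) hf hg
  · have hlt : DefPred fun w : Option (Fin 2) → ℕ => w (some 0) < w (some 1) :=
      .lt (.var _) (.var _)
    exact .or (.and hlt (.eq (.add (.sq (.var _)) (.var _)) (.var _))) <|
      .and hlt.not (.eq (.add (.add (.sq (.var _)) (.var _)) (.var _)) (.var _))
  · unfold Nat.pair
    split_ifs with h <;> simp [h]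

theorem unpair_fst (hf : DefFun f) : DefFun fun v => (f v).unpair.1 := by
  refine subst₂ (op := fun a _ => a.unpair.1) (of_graph (R := fun v z =>
    ∃ y, Nat.pair z y = v 0) ?_ fun v z => ?_) hf hf
  · exact .ex (.eq (.pair (.var _) (.var _)) (.var _))
  · constructor
    · rintro rfl
      exact ⟨_, Nat.pair_unpair _⟩
    · rintro ⟨y, h⟩
      simp [← h]

theorem unpair_snd (hf : DefFun f) : DefFun fun v => (f v).unpair.2 := by
  refine subst₂ (op := fun a _ => a.unpair.2) (of_graph (R := fun v z =>
    ∃ y, Nat.pair y z = v 0) ?_ fun v z => ?_) hf hf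
  · exact .ex (.eq (.pair (.var _) (.var _)) (.var _))
  · constructor
    · rintro rfl
      exact ⟨_, Nat.pair_unpair _⟩
    · rintro ⟨y, h⟩
      simp [← h]

theorem beta (hf : DefFun f) (hg : DefFun g) : DefFun fun v => Nat.beta (f v) (g v) :=
  .mod (.unpair_fst hf) (.succ (.mul (.succ hg) (.unpair_snd hf)))

end DefFun

/-! ### Definability of partial recursive functions -/

/-- Every finite initial segment of a sequence is coded by a number via `Nat.beta`. -/
theorem exists_beta_eq (s : ℕ → ℕ) (n : ℕ) : ∃ b, ∀ i ≤ n, Nat.beta b i = s i := by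
  refine ⟨Nat.unbeta ((List.range (n + 1)).map s), fun i hi => ?_⟩
  have h := Nat.beta_unbeta_coe ((List.range (n + 1)).map s)
    ⟨i, by rw [List.length_map, List.length_range]; omega⟩
  simpa using h

section PrimitiveRecursion

variable (x : Part ℕ) (g : ℕ → ℕ → Part ℕ)

/-- The values of a partial function defined by primitive recursion are witnessed by the finite
sequence of its intermediate values. -/
theorem mem_rec_iff_exists_seq (n y : ℕ) :
    (y ∈ (Nat.rec x (fun i IH => IH.bind (g i)) n : Part ℕ)) ↔
      ∃ s : ℕ → ℕ, s 0 ∈ x ∧ (∀ i < n, s (i + 1) ∈ g i (s i)) ∧ y = s n := by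
  induction n generalizing y with
  | zero =>
    constructor
    · intro h
      exact ⟨fun _ => y, h, by simp, rfl⟩
    · rintro ⟨s, h, -, rfl⟩
      exact h
  | succ n ih =>
    refine Part.mem_bind_iff.trans ?_
    constructor
    · rintro ⟨z, hz, hy⟩
      obtain ⟨s, h0, hs, rfl⟩ := (ih z).1 hz
      refine ⟨Function.update s (n + 1) y, ?_, fun i hi => ?_, ?_⟩
      · rwa [Function.update_of_ne (by omega)]
      · rw [Function.update_of_ne (show i ≠ n + 1 by omega)]
        rcases Nat.lt_succ_iff_lt_or_eq.1 hi with h | rfl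
        · rw [Function.update_of_ne (by omega)]
          exact hs i h
        · rwa [Function.update_self]
      · rw [Function.update_self]
    · rintro ⟨s, h0, hs, rfl⟩
      exact ⟨s n, (ih _).2 ⟨s, h0, fun i hi => hs i (by omega), rfl⟩, hs n (by omega)⟩

theorem mem_rec_iff_exists_beta (n y : ℕ) :
    (y ∈ (Nat.rec x (fun i IH => IH.bind (g i)) n : Part ℕ)) ↔
      ∃ b, Nat.beta b 0 ∈ x ∧ (∀ i, i < n → Nat.beta b (i + 1) ∈ g i (Nat.beta b i)) ∧
        y = Nat.beta b n := by
  rw [mem_rec_iff_exists_seq]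
  constructor
  · rintro ⟨s, h0, hs, rfl⟩
    obtain ⟨b, hb⟩ := exists_beta_eq s n
    refine ⟨b, ?_, fun i hi => ?_, ?_⟩
    · rwa [hb 0 (by omega)]
    · rw [hb _ hi, hb _ hi.le]
      exact hs i hi
    · rw [hb n le_rfl]
  · rintro ⟨b, h⟩
    exact ⟨Nat.beta b, h⟩

end PrimitiveRecursion

/-- Every partial recursive function has a definable graph. -/
theorem defPred_graph_of_partrec {f : ℕ →. ℕ} (hf : Nat.Partrec f) :
    DefPred fun v : Fin 2 → ℕ => v 1 ∈ f (v 0) := by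
  induction hf with
  | zero => exact (DefPred.eq (.var 1) .zero).of_iff fun v => by simp [pure, PFun.pure]
  | succ => exact (DefPred.eq (.var 1) (.succ (.var 0))).of_iff fun v => by simp
  | left => exact (DefPred.eq (.var 1) (.unpair_fst (.var 0))).of_iff fun v => by simp
  | right => exact (DefPred.eq (.var 1) (.unpair_snd (.var 0))).of_iff fun v => by simp
  | @pair f g _ _ ihf ihg =>
    refine DefPred.of_iff (P := fun v => ∃ a b, a ∈ f (v 0) ∧ b ∈ g (v 0) ∧ v 1 = Nat.pair a b)
      ?_ fun v => ?_
    · exact .ex <| .ex <| .and (.subst₂ (R := fun x y => y ∈ f x) ihf (.var _) (.var _)) <|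
        .and (.subst₂ (R := fun x y => y ∈ g x) ihg (.var _) (.var _)) <|
        .eq (.var _) (.pair (.var _) (.var _))
    · simp [Seq.seq, eq_comm]
  | @comp f g _ _ ihf ihg =>
    refine DefPred.of_iff (P := fun v => ∃ a, a ∈ g (v 0) ∧ v 1 ∈ f a) ?_ fun v => ?_
    · exact .ex <| .and (.subst₂ (R := fun x y => y ∈ g x) ihg (.var _) (.var _)) <|
        .subst₂ (R := fun x y => y ∈ f x) ihf (.var _) (.var _)
    · exact Part.mem_bind_iff
  | @prec f g _ _ ihf ihg =>
    refine DefPred.of_iff (P := fun v => ∃ b, Nat.beta b 0 ∈ f (v 0).unpair.1 ∧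
      (∀ i, i < (v 0).unpair.2 → Nat.beta b (i + 1) ∈
        g (Nat.pair (v 0).unpair.1 (Nat.pair i (Nat.beta b i)))) ∧
      v 1 = Nat.beta b (v 0).unpair.2) ?_ fun v => ?_
    · exact .ex <| .and
        (.subst₂ (R := fun x y => y ∈ f x) ihf (.unpair_fst (.var _)) (.beta (.var _) .zero)) <|
        .and (.all <| .imp (.lt (.var _) (.unpair_snd (.var _))) <|
          .subst₂ (R := fun x y => y ∈ g x) ihg
            (.pair (.unpair_fst (.var _)) (.pair (.var _) (.beta (.var _) (.var _))))
            (.beta (.var _) (.succ (.var _)))) <|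
        .eq (.var _) (.beta (.var _) (.unpair_snd (.var _)))
    · exact mem_rec_iff_exists_beta (f (v 0).unpair.1)
        (fun i z => g (Nat.pair (v 0).unpair.1 (Nat.pair i z))) _ _
  | @rfind f _ ihf =>
    refine DefPred.of_iff (P := fun v => 0 ∈ f (Nat.pair (v 0) (v 1)) ∧
      ∀ i, i < v 1 → ∃ z, z ∈ f (Nat.pair (v 0) i) ∧ ¬ z = 0) ?_ fun v => ?_
    · exact .and (.subst₂ (R := fun x y => y ∈ f x) ihf (.pair (.var _) (.var _)) .zero) <|
        .all <| .imp (.lt (.var _) (.var _)) <| .ex <|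
        .and (.subst₂ (R := fun x y => y ∈ f x) ihf (.pair (.var _) (.var _)) (.var _)) <|
        .not (.eq (.var _) .zero)
    · refine Nat.mem_rfind.trans ?_
      simp

/-- The set of numbers of programs that halt on input `0` is definable. -/
theorem defPred_halts :
    DefPred fun v : Fin 1 → ℕ => ((Denumerable.ofNat Nat.Partrec.Code (v 0)).eval 0).Dom := by
  have hp : Nat.Partrec fun m => (Denumerable.ofNat Nat.Partrec.Code m).eval 0 :=
    Partrec.nat_iff.1 <|
      Nat.Partrec.Code.eval_part.comp (Computable.ofNat _) (Computable.const 0)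
  have h := defPred_graph_of_partrec hp
  exact (DefPred.ex (P := fun v y => y ∈ (Denumerable.ofNat Nat.Partrec.Code (v 0)).eval 0)
    (.subst₂ (R := fun x y => y ∈ (Denumerable.ofNat Nat.Partrec.Code x).eval 0) h
      (.var _) (.var _))).of_iff fun v => Part.dom_iff_mem

/-! ### Sentences about individual numbers and their Gödel numbers -/

/-- A formula expressing that the last variable `x_n` is smaller than `k`. For `k = 0` it is `⊥`;
for `k ≠ 0` it says that every `x_{n+1} < x_n` is smaller than `k - 1`, where `y < x` is spelled out
as `y mod x = y` together with `x mod x ≠ x`, the latter meaning `x ≠ 0`. -/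
def ltFormula : (k n : ℕ) → modLanguage.BoundedFormula Empty (n + 1)
  | 0, _ => .falsum
  | k + 1, n => .all <| .imp
      (.equal (.func ModFunc.mod
          ![.var (.inr (Fin.last (n + 1))), .var (.inr (Fin.last n).castSucc)])
        (.var (.inr (Fin.last (n + 1)))))
      (.imp
        (.imp (.equal (.func ModFunc.mod
            ![.var (.inr (Fin.last n).castSucc), .var (.inr (Fin.last n).castSucc)])
          (.var (.inr (Fin.last n).castSucc))) .falsum)
        (ltFormula k (n + 1)))

theorem realize_ltFormula (k n : ℕ) (v : Empty → ℕ) (xs : Fin (n + 1) → ℕ) :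
    (ltFormula k n).Realize v xs ↔ xs (Fin.last n) < k := by
  induction k generalizing n with
  | zero => simp [ltFormula, BoundedFormula.Realize]
  | succ k ih =>
    have hmod (v : Fin 2 → ℕ) : Structure.funMap (L := modLanguage) ModFunc.mod v = v 0 % v 1 :=
      rfl
    simp only [ltFormula, BoundedFormula.Realize, ih, Term.realize, hmod, Matrix.cons_val_zero,
      Matrix.cons_val_one, Sum.elim_inr, Fin.snoc_last, Fin.snoc_castSucc, Nat.mod_self]
    constructor
    · intro h
      rcases Nat.eq_zero_or_pos (xs (Fin.last n)) with h0 | hpos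
      · omega
      -- the predecessor of `x_n` is the binding instance
      · have := h (xs (Fin.last n) - 1) (Nat.mod_eq_of_lt (by omega)) (by omega)
        omega
    · intro h y hy h0
      have := Nat.mod_lt y (Nat.pos_of_ne_zero fun e => h0 e.symm)
      omega

/-- The Gödel number of `ltFormula (k + 1) n` in terms of that of `ltFormula k (n + 1)`. -/
def ltCodeStep (n r : ℕ) : ℕ :=
  3 * (3 * Nat.pair
    (3 * Nat.pair (2 * Nat.pair (2 * (n + 1)) (2 * n) + 1) (2 * (n + 1)) + 1)
    (3 * Nat.pair
      (3 * Nat.pair (3 * Nat.pair (2 * Nat.pair (2 * n) (2 * n) + 1) (2 * n) + 1) 0 + 2)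
      r + 2) + 2) + 3

theorem formulaCode_ltFormula_succ (k n : ℕ) :
    formulaCode (ltFormula (k + 1) n) = ltCodeStep n (formulaCode (ltFormula k (n + 1))) := by
  simp [ltFormula, formulaCode, termCode, ltCodeStep]

/-- The Gödel number of `ltFormula j (k - j)` for `j ≤ k`, by recursion on `j`. Recursion along
`ltFormula` itself changes the parameter `n`; building the formula for a fixed `k` from the inside
out turns this into an ordinary primitive recursion. -/
def ltCode (k : ℕ) : ℕ → ℕ
  | 0 => 0
  | j + 1 => ltCodeStep (k - (j + 1)) (ltCode k j)

theorem ltCode_eq {k j : ℕ} (h : j ≤ k) : ltCode k j = formulaCode (ltFormula j (k - j)) := by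
  induction j with
  | zero => rfl
  | succ j ih =>
    rw [formulaCode_ltFormula_succ, ltCode, ih (by omega), show k - (j + 1) + 1 = k - j by omega]

theorem ltCode_self (k : ℕ) : ltCode k k = formulaCode (ltFormula k 0) := by
  rw [ltCode_eq le_rfl, Nat.sub_self]

open Primrec in
theorem primrec_ltCodeStep : Primrec₂ ltCodeStep := by
  have add {f g : ℕ × ℕ → ℕ} (hf : Primrec f) (hg : Primrec g) :
      Primrec fun p => f p + g p := nat_add.comp hf hg
  have mul {f g : ℕ × ℕ → ℕ} (hf : Primrec f) (hg : Primrec g) :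
      Primrec fun p => f p * g p := nat_mul.comp hf hg
  have pair {f g : ℕ × ℕ → ℕ} (hf : Primrec f) (hg : Primrec g) :
      Primrec fun p => Nat.pair (f p) (g p) := Primrec₂.natPair.comp hf hg
  have c (m : ℕ) : Primrec fun _ : ℕ × ℕ => m := .const m
  have hn := mul (c 2) fst
  have hn' := mul (c 2) (add fst (c 1))
  have h₁ := add (mul (c 3) (pair (add (mul (c 2) (pair hn' hn)) (c 1)) hn')) (c 1)
  have h₂ := add (mul (c 3) (pair (add (mul (c 2) (pair hn hn)) (c 1)) hn)) (c 1)
  have h₃ := add (mul (c 3) (pair h₂ (c 0))) (c 2)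
  exact add (mul (c 3) (add (mul (c 3) (pair h₁ (add (mul (c 3) (pair h₃ snd)) (c 2))))
    (c 2))) (c 3)

open Primrec in
theorem primrec_ltCode_self : Primrec fun k => ltCode k k := by
  refine (nat_rec' (f := fun k : ℕ => k) (g := fun _ => 0)
    (h := fun k p => ltCodeStep (k - (p.1 + 1)) p.2) .id (.const 0) ?_).of_eq fun k => ?_
  · exact primrec_ltCodeStep.comp
      (nat_sub.comp fst (succ.comp (fst.comp snd))) (snd.comp snd)
  · have h (j : ℕ) : ltCode k j =
        Nat.rec 0 (fun y IH => ltCodeStep (k - (y + 1)) IH) j := by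
      induction j with
      | zero => rfl
      | succ j ih => rw [ltCode, ih]
    exact (h k).symm

/-- The sentence `∀ x, x < m + 1 → ¬ x < m → φ x`, which states `φ m`. -/
def instantiate (φ : modLanguage.BoundedFormula Empty 1) (m : ℕ) : modLanguage.Sentence :=
  .all <| .imp (ltFormula (m + 1) 0) <| .imp (.imp (ltFormula m 0) .falsum) φ

theorem realize_instantiate (φ : modLanguage.BoundedFormula Empty 1) (m : ℕ) :
    ℕ ⊨ instantiate φ m ↔ φ.Realize default fun _ => m := by
  have hlt (k a : ℕ) (v : Empty → ℕ) (xs : Fin 0 → ℕ) :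
      (ltFormula k 0).Realize v (Fin.snoc xs a) ↔ a < k := by
    rw [realize_ltFormula, Fin.snoc_last]
  have hcons (a : ℕ) (xs : Fin 0 → ℕ) : (Fin.snoc xs a : Fin (0 + 1) → ℕ) = fun _ => a := by
    funext i
    rw [Fin.fin_one_eq_zero i]
    exact Fin.snoc_last (n := 0) (α := fun _ => ℕ) a xs
  simp only [instantiate, Sentence.Realize, Formula.Realize, BoundedFormula.Realize]
  constructor
  · intro h
    have hm := h m ((hlt _ _ _ _).2 m.lt_succ_self) fun h' => lt_irrefl m ((hlt _ _ _ _).1 h')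
    rw [hcons] at hm
    convert hm
  · intro h a h₁ h₂
    have ha : a < m + 1 := (hlt _ _ _ _).1 h₁
    have ha' : ¬ a < m := fun h' => h₂ ((hlt _ _ _ _).2 h')
    rw [hcons, show a = m by omega]
    convert h

theorem primrec_sentenceCode_instantiate (φ : modLanguage.BoundedFormula Empty 1) :
    Primrec fun m => sentenceCode (instantiate φ m) := by
  have h (m : ℕ) : sentenceCode (instantiate φ m) =
      3 * (3 * Nat.pair (ltCode (m + 1) (m + 1))
        (3 * Nat.pair (3 * Nat.pair (ltCode m m) 0 + 2) (formulaCode φ) + 2) + 2) + 3 := by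
    simp [sentenceCode, instantiate, formulaCode, ltCode_self]
  have lin (a b : ℕ) {f : ℕ → ℕ} (hf : Primrec f) : Primrec fun m => a * f m + b :=
    Primrec.nat_add.comp (Primrec.nat_mul.comp (.const a) hf) (.const b)
  have pair {f g : ℕ → ℕ} (hf : Primrec f) (hg : Primrec g) :
      Primrec fun p => Nat.pair (f p) (g p) := Primrec₂.natPair.comp hf hg
  refine Primrec.of_eq ?_ fun m => (h m).symm
  exact lin 3 3 <| lin 3 2 <| pair (primrec_ltCode_self.comp .succ) <| lin 3 2 <|
    pair (lin 3 2 (pair primrec_ltCode_self (.const 0))) (.const _)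

/-! ### Deciding definable sets -/

/-- A decidable complete theory of `(ℕ, mod)` makes every definable set of numbers computable. -/
theorem computablePred_of_isDecidable (h : IsDecidable (modLanguage.completeTheory ℕ))
    {P : ℕ → Prop} (hP : DefPred fun v : Fin 1 → ℕ => P (v 0)) : ComputablePred P := by
  obtain ⟨f, hf, hdec⟩ := h
  obtain ⟨φ, hφ⟩ := empty_definable_iff.1 hP
  -- turn the free variable of `φ` into the de Bruijn level `0`
  let ψ : modLanguage.BoundedFormula Empty 1 := BoundedFormula.relabel Sum.inr φ
  have hψ (m : ℕ) : f (sentenceCode (instantiate ψ m)) = true ↔ P m := by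
    rw [hdec, mem_completeTheory, realize_instantiate]
    exact (Formula.realize_relabel_sumInr φ).trans (Set.ext_iff.1 hφ fun _ => m).symm
  refine ComputablePred.computable_iff.2
    ⟨_, hf.comp (primrec_sentenceCode_instantiate ψ).to_comp, funext fun m => ?_⟩
  exact propext (hψ m).symm

end ModArith

theorem mainTheorem1 :
    ¬ ModArith.IsDecidable (ModArith.modLanguage.completeTheory ℕ) := by
  intro h
  refine ComputablePred.halting_problem 0 ?_
  obtain ⟨g, hg, hgP⟩ := ComputablePred.computable_iff.1
    (ModArith.computablePred_of_isDecidable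
      (P := fun m => ((Denumerable.ofNat Nat.Partrec.Code m).eval 0).Dom) h ModArith.defPred_halts)
  refine ComputablePred.computable_iff.2 ⟨_, hg.comp Computable.encode, funext fun c => ?_⟩
  have h := congrFun hgP (Encodable.encode c)
  rwa [Denumerable.ofNat_encode] at h
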